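/- All logarithms are in base $2$ and graphs are finite and simple. For a graph $G$, let $G^{\boxtimes m}$ be its $m$-fold strong product: the vertex set is $V(G)^m$, and distinct tuples are adjacent iff in each coordinate they are equal or adjacent in $G$. Write $\overline{G}$ for the complement of $G$ and $G\longrightarrow G'$ if there is a graph homomorphism from $G$ to $G'$. For graphs $G,H$ (such that $G$ and $\overline H$ each have at least one edge) and $m\ge 1$, let $$\eta_m(G,H)=\min\{n\in\mathbb N : G^{\boxtimes m}\longrightarrow \overline{H^{\boxtimes n}}\},\qquad \eta(G,H)=\lim_{m\to\infty}\tfrac1m\,\eta_m(G,H),$$ and let $\eta^\star_m(G,H)$ be the least $n\in\mathbb N$ for which there are $d\in\mathbb N$ and positive semidefinite matrices $\rho$ and $\rho_{x}^{s}$ ($x\in V(G^{\boxtimes m})$, $s\in V(H^{\boxtimes n})$) in $\mathbb C^{d\times d}$ such that $\operatorname{Tr}\rho=1$, $\sum_{s}\rho_x^s=\rho$ for every $x$, and $\rho_x^s\rho_y^t=0$ whenever $\{x,y\}\in E(G^{\boxtimes m})$ and ($s=t$ or $\{s,t\}\in E(H^{\boxtimes n})$). Let $\eta^\star(G,H)=\lim_{m\to\infty}\frac1m\,\eta^\star_m(G,H)$.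 For odd $k\ge 1$, the quarter-orthogonality graph $H_k$ has as vertices the vectors in $\{-1,1\}^k$ with an even number of entries $-1$, two of them being adjacent iff their inner product is $-1$. A Hadamard matrix of size $N$ is a matrix $A\in\{-1,1\}^{N\times N}$ with $AA^{\mathsf T}=NI$. **Theorem.** Let $p$ be an odd prime and $\ell\ge 1$ an integer such that there exists a Hadamard matrix of size $4p^\ell$, and let $k=4p^\ell-1$. Then the minima and the limits defining $\eta(H_k,H_k)$ and $\eta^\star(H_k,H_k)$ exist, and $$\eta^\star(H_k,H_k)\ \le\ \frac{\log(k+1)}{(k-1)\left(1-\frac{2\log(k+1)}{k-3}\right)},\qquad \eta(H_k,H_k)\ >\ \frac{0.154\,k-1}{k-1-\log(k+1)}.$$ In particular, there are absolute constants $C,c>0$ such that $\eta^\star(H_k,H_k)\le C\,\frac{\log k}{k}$ and $\eta(H_k,H_k)\ge c$ for every such $k$. -/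

import Mathlib

open scoped ComplexOrder

/-- The `m`-fold strong product power `G^{⊠ m}`: distinct tuples `x, y` are adjacent iff in every
coordinate they are equal or adjacent in `G`. -/
def strongPower {V : Type*} (G : SimpleGraph V) (m : ℕ) : SimpleGraph (Fin m → V) where
  Adj x y := x ≠ y ∧ ∀ i, x i = y i ∨ G.Adj (x i) (y i)
  symm := ⟨fun _ _ h => ⟨h.1.symm, fun i => (h.2 i).imp Eq.symm fun a => a.symm⟩⟩
  loopless := ⟨fun _ h => h.1 rfl⟩

/-- There is a zero-error `(m, n)`-coding scheme for a source with characteristic graph `G` and a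
channel with confusability graph `H`: a homomorphism from `G^{⊠ m}` to the complement of
`H^{⊠ n}`. -/
def HasScheme {V W : Type*} (G : SimpleGraph V) (H : SimpleGraph W) (m n : ℕ) : Prop :=
  Nonempty (strongPower G m →g (strongPower H n)ᶜ)

/-- There is an entanglement-assisted zero-error `(m, n)`-coding scheme, expressed by positive
semidefinite matrices `ρ` and `σ x s` (the unnormalised states of the receiver's register when the
source input is `x` and the channel input is `s`). -/
def HasEntangledScheme {V W : Type*} [Fintype W] (G : SimpleGraph V) (H : SimpleGraph W)
    (m n : ℕ) : Prop :=
  ∃ (d : ℕ) (ρ : Matrix (Fin d) (Fin d) ℂ)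
    (σ : (Fin m → V) → (Fin n → W) → Matrix (Fin d) (Fin d) ℂ),
    ρ.PosSemidef ∧ (∀ x s, (σ x s).PosSemidef) ∧ ρ.trace = 1 ∧
    (∀ x y, (strongPower G m).Adj x y → ∀ s t, (s = t ∨ (strongPower H n).Adj s t) →
      σ x s * σ y t = 0) ∧
    ∀ x, ∑ s, σ x s = ρ

/-- `η_m(G, H)`: the least `n` admitting an `(m, n)`-coding scheme. -/
noncomputable def minCost {V W : Type*} (G : SimpleGraph V) (H : SimpleGraph W) (m : ℕ) : ℕ :=
  sInf {n : ℕ | HasScheme G H m n}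

/-- `η⋆_m(G, H)`: the least `n` admitting an entanglement-assisted `(m, n)`-coding scheme. -/
noncomputable def entangledMinCost {V W : Type*} [Fintype W] (G : SimpleGraph V)
    (H : SimpleGraph W) (m : ℕ) : ℕ :=
  sInf {n : ℕ | HasEntangledScheme G H m n}

/-- The source-channel cost rate `η(G, H) = lim_{m → ∞} η_m(G, H) / m`. -/
noncomputable def costRate {V W : Type*} (G : SimpleGraph V) (H : SimpleGraph W) : ℝ :=
  Filter.limUnder Filter.atTop fun m : ℕ => (minCost G H m : ℝ) / m

/-- The entangled source-channel cost rate `η⋆(G, H) = lim_{m → ∞} η⋆_m(G, H) / m`. -/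
noncomputable def entangledCostRate {V W : Type*} [Fintype W] (G : SimpleGraph V)
    (H : SimpleGraph W) : ℝ :=
  Filter.limUnder Filter.atTop fun m : ℕ => (entangledMinCost G H m : ℝ) / m

/-- The vectors in `{-1, 1}^k` with an even number of entries `-1`. -/
abbrev EvenSignVector (k : ℕ) : Type :=
  {v : Fin k → ℤˣ // Even (Finset.univ.filter fun i => v i = -1).card}

/-- The quarter-orthogonality graph `H_k` (used for odd `k`): the vertices are the sign vectors of
length `k` with an even number of entries `-1`; edges are the pairs with inner product `-1`. -/
def quarterOrthogonalityGraph (k : ℕ) : SimpleGraph (EvenSignVector k) where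
  Adj u v := ∑ i, (u.1 i : ℤ) * (v.1 i : ℤ) = -1
  symm := ⟨fun u v h => by simpa only [mul_comm] using h⟩
  loopless := ⟨fun u h => by
    have h0 : 0 ≤ ∑ i, (u.1 i : ℤ) * (u.1 i : ℤ) :=
      Finset.sum_nonneg fun i _ => mul_self_nonneg _
    rw [h] at h0
    exact absurd h0 (by decide)⟩

/-! ### Coding schemes: concatenation, existence of the limits, and schemes built from vectors -/

section Schemes

open Matrix Kronecker

variable {V W : Type*} {G : SimpleGraph V} {H : SimpleGraph W}

/-! Put N = k + 1 = 4q with q = p^ℓ. Prefixing a 1 to each vertex of H_k gives vectors in dimension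
N that are orthogonal exactly at edges, and a normalised Hadamard matrix gives a clique B of size N
whose extended vectors form an orthogonal basis. Both bounds use the translates tB in the group of
even sign vectors.

Entangled upper bound (`hasEntangledScheme_of_packing`): measuring in the basis B twisted by x
leaves the receiver needing only the outcome, one of N per source letter, to separate adjacent
inputs by orthogonality. Outcomes are sent as pairwise disjoint translates of B, again separated by
orthogonality. A maximal packing has at least 2^(k-1)/N² translates (`exists_packing`), so about log
N / (k - 1 - 2 log N) channel uses per letter suffice.

Classical lower bound (`card_mul_pow_le_of_hasScheme`): a scheme pulls each translate of B^n back to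
an independent set of the source power, and every codeword lies in N^n translates. By
`card_le_of_independent`, a rank argument over F_p, independent sets have at most b^m elements,
where b counts the subsets of a k-set of size below q. An entropy estimate gives log b ≤ 13k/16, so
the rate stays bounded below. -/

theorem eq_or_strongPower_adj_iff {m : ℕ} {x y : Fin m → V} :
    (x = y ∨ (strongPower G m).Adj x y) ↔ ∀ i, x i = y i ∨ G.Adj (x i) (y i) := by
  constructor
  · rintro (rfl | h) i
    · exact Or.inl rfl
    · exact h.2 i
  · intro h
    by_cases hxy : x = y
    · exact Or.inl hxy
    · exact Or.inr ⟨hxy, h⟩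

theorem hasScheme_iff {m n : ℕ} :
    HasScheme G H m n ↔ ∃ f : (Fin m → V) → (Fin n → W), ∀ x y, (strongPower G m).Adj x y →
      ¬ ∀ i, f x i = f y i ∨ H.Adj (f x i) (f y i) := by
  constructor
  · rintro ⟨f⟩
    refine ⟨f, fun x y hxy hall => ?_⟩
    have h := f.map_adj hxy
    rw [SimpleGraph.compl_adj] at h
    exact h.2 ⟨h.1, hall⟩
  · rintro ⟨f, hf⟩
    refine ⟨⟨f, fun {x y} hxy => ?_⟩⟩
    rw [SimpleGraph.compl_adj]
    exact ⟨fun h => hf x y hxy fun i => Or.inl (congrFun h i), fun h => hf x y hxy h.2⟩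

theorem strongPower_adj_append {m m' : ℕ} {x y : Fin (m + m') → V}
    (h : (strongPower G (m + m')).Adj x y) :
    (strongPower G m).Adj (fun i => x (Fin.castAdd m' i)) (fun i => y (Fin.castAdd m' i)) ∨
    (strongPower G m').Adj (fun i => x (Fin.natAdd m i)) (fun i => y (Fin.natAdd m i)) := by
  by_cases h1 : (fun i => x (Fin.castAdd m' i)) = fun i => y (Fin.castAdd m' i)
  · refine Or.inr ⟨fun h2 => h.1 ?_, fun i => h.2 _⟩
    funext i
    exact Fin.addCases (fun i => congrFun h1 i) (fun i => congrFun h2 i) i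
  · exact Or.inl ⟨h1, fun i => h.2 _⟩

theorem HasScheme.append {m m' n n' : ℕ} (h : HasScheme G H m n) (h' : HasScheme G H m' n') :
    HasScheme G H (m + m') (n + n') := by
  rw [hasScheme_iff] at *
  obtain ⟨f, hf⟩ := h
  obtain ⟨f', hf'⟩ := h'
  refine ⟨fun x => Fin.append (f fun i => x (Fin.castAdd m' i)) (f' fun i => x (Fin.natAdd m i)),
    fun x y hxy hall => ?_⟩
  rcases strongPower_adj_append hxy with h | h
  · exact hf _ _ h fun i => by simpa using hall (Fin.castAdd n' i)
  · exact hf' _ _ h fun i => by simpa using hall (Fin.natAdd n i)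

/-- Frees the register from the index type `Fin d`, so that Kronecker products can be used directly.
-/
theorem hasEntangledScheme_of_fintype [Fintype W] {m n : ℕ} {ι : Type*} [Fintype ι]
    [DecidableEq ι] (ρ : Matrix ι ι ℂ) (σ : (Fin m → V) → (Fin n → W) → Matrix ι ι ℂ)
    (hρ : ρ.PosSemidef) (hσ : ∀ x s, (σ x s).PosSemidef) (htr : ρ.trace = 1)
    (hort : ∀ x y, (strongPower G m).Adj x y → ∀ s t, (s = t ∨ (strongPower H n).Adj s t) →
      σ x s * σ y t = 0)
    (hsum : ∀ x, ∑ s, σ x s = ρ) : HasEntangledScheme G H m n := by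
  let e := (Fintype.equivFin ι).symm
  refine ⟨Fintype.card ι, ρ.submatrix e e, fun x s => (σ x s).submatrix e e, hρ.submatrix e,
    fun x s => (hσ x s).submatrix e, ?_, fun x y hxy s t hst => ?_, fun x => ?_⟩
  · rw [← htr]
    exact e.sum_comp fun i => ρ i i
  · rw [Matrix.submatrix_mul_equiv, hort x y hxy s t hst]
    rfl
  · ext i j
    rw [← hsum x]
    simp [Matrix.sum_apply]

theorem HasEntangledScheme.append [Fintype W] {m m' n n' : ℕ} (h : HasEntangledScheme G H m n)
    (h' : HasEntangledScheme G H m' n') : HasEntangledScheme G H (m + m') (n + n') := by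
  obtain ⟨d, ρ, σ, hρ, hσ, htr, hort, hsum⟩ := h
  obtain ⟨d', ρ', σ', hρ', hσ', htr', hort', hsum'⟩ := h'
  refine hasEntangledScheme_of_fintype (ρ ⊗ₖ ρ')
    (fun x s => σ (fun i => x (Fin.castAdd m' i)) (fun i => s (Fin.castAdd n' i)) ⊗ₖ
      σ' (fun i => x (Fin.natAdd m i)) (fun i => s (Fin.natAdd n i)))
    (hρ.kronecker hρ') (fun x s => (hσ _ _).kronecker (hσ' _ _)) ?_ ?_ ?_
  · rw [trace_kronecker, htr, htr', one_mul]
  · intro x y hxy s t hst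
    rw [← mul_kronecker_mul]
    rw [eq_or_strongPower_adj_iff] at hst
    rcases strongPower_adj_append hxy with h | h
    · rw [hort _ _ h _ _ (eq_or_strongPower_adj_iff.2 fun i => hst _), zero_kronecker]
    · rw [hort' _ _ h _ _ (eq_or_strongPower_adj_iff.2 fun i => hst _), kronecker_zero]
  · intro x
    rw [← hsum fun i => x (Fin.castAdd m' i), ← hsum' fun i => x (Fin.natAdd m i),
      ← (Fin.appendEquiv n n').sum_comp, Fintype.sum_prod_type]
    ext ⟨a, a'⟩ ⟨b, b'⟩
    simp [Matrix.sum_apply, Fin.appendEquiv, Finset.sum_mul_sum]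

/-- A deterministic encoding is an entangled scheme with a one-dimensional register. -/
theorem HasScheme.hasEntangledScheme [Fintype W] {m n : ℕ} (h : HasScheme G H m n) :
    HasEntangledScheme G H m n := by
  classical
  obtain ⟨f, hf⟩ := hasScheme_iff.1 h
  refine ⟨1, 1, fun x s => if f x = s then 1 else 0, PosSemidef.one, fun x s => ?_, by simp, ?_,
    fun x => by simp⟩
  · dsimp only
    split_ifs
    exacts [PosSemidef.one, PosSemidef.zero]
  · intro x y hxy s t hst
    dsimp only
    split_ifs with h1 h2
    · subst h1 h2
      exact absurd (eq_or_strongPower_adj_iff.1 hst) (hf x y hxy)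
    all_goals simp

/-- Unary code: each input owns one channel coordinate, where it sends `a` and all other inputs send
`b`. -/
theorem hasScheme_of_not_adj [Finite V] {a b : W} (hab : a ≠ b) (hnadj : ¬ H.Adj a b) (m : ℕ) :
    ∃ n, HasScheme G H m n := by
  classical
  have := Fintype.ofFinite V
  let e := Fintype.equivFin (Fin m → V)
  refine ⟨Fintype.card (Fin m → V), hasScheme_iff.2 ⟨fun x i => if e x = i then a else b,
    fun x y hxy hall => ?_⟩⟩
  have hne : e y ≠ e x := fun h => hxy.1 (e.injective h).symm
  have := hall (e x)
  simp [hne, hab, hnadj] at this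

/-- Fekete's lemma: concatenating schemes makes the minimal cost subadditive. -/
theorem tendsto_sInf_div (P : ℕ → ℕ → Prop) (hex : ∀ m, ∃ n, P m n)
    (hadd : ∀ m m' n n', P m n → P m' n' → P (m + m') (n + n')) :
    ∃ l : ℝ, Filter.Tendsto (fun m : ℕ => ((sInf {n | P m n} : ℕ) : ℝ) / m) Filter.atTop
      (nhds l) := by
  have hsub : Subadditive fun m : ℕ => ((sInf {n | P m n} : ℕ) : ℝ) := fun m m' => by
    have h := Nat.sInf_mem (s := {n | P m n}) (hex m)
    have h' := Nat.sInf_mem (s := {n | P m' n}) (hex m')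
    dsimp only
    exact_mod_cast Nat.sInf_le (s := {n | P (m + m') n}) (hadd _ _ _ _ h h')
  refine ⟨hsub.lim, hsub.tendsto_lim ⟨0, ?_⟩⟩
  rintro _ ⟨n, rfl⟩
  positivity

theorem tendsto_costRate (hex : ∀ m, ∃ n, HasScheme G H m n) :
    Filter.Tendsto (fun m : ℕ => (minCost G H m : ℝ) / m) Filter.atTop
      (nhds (costRate G H)) :=
  tendsto_nhds_limUnder (tendsto_sInf_div _ hex fun _ _ _ _ h h' => h.append h')

theorem tendsto_entangledCostRate [Fintype W] (hex : ∀ m, ∃ n, HasEntangledScheme G H m n) :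
    Filter.Tendsto (fun m : ℕ => (entangledMinCost G H m : ℝ) / m) Filter.atTop
      (nhds (entangledCostRate G H)) :=
  tendsto_nhds_limUnder (tendsto_sInf_div _ hex fun _ _ _ _ h h' => h.append h')

/-- An entanglement-assisted scheme from integer vectors: the states are sums of the rank-one
matrices of the vectors `w x s c`. -/
theorem hasEntangledScheme_of_vectors [Fintype W] {m n : ℕ} {ι C : Type*} [Fintype ι] [Nonempty ι]
    [DecidableEq ι] [Fintype C] (w : (Fin m → V) → (Fin n → W) → C → ι → ℤ) (N : ℕ) (hN : N ≠ 0)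
    (hort : ∀ x y, (strongPower G m).Adj x y → ∀ s t, (s = t ∨ (strongPower H n).Adj s t) →
      ∀ c c', w x s c ⬝ᵥ w y t c' = 0)
    (hsum : ∀ x i j, ∑ s, ∑ c, w x s c i * w x s c j = if i = j then (N : ℤ) else 0) :
    HasEntangledScheme G H m n := by
  have hcard : (Fintype.card ι : ℂ) ≠ 0 := Nat.cast_ne_zero.2 Fintype.card_ne_zero
  have hN' : (N : ℂ) ≠ 0 := Nat.cast_ne_zero.2 hN
  let z : (Fin m → V) → (Fin n → W) → C → ι → ℂ := fun x s c i => (w x s c i : ℂ)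
  have hstar : ∀ x s c, star (z x s c) = z x s c := fun x s c => by ext i; simp [z]
  have hpos : (0 : ℂ) ≤ (((Fintype.card ι * N : ℕ) : ℂ))⁻¹ := by positivity
  have hpos' : (0 : ℂ) ≤ (Fintype.card ι : ℂ)⁻¹ := by positivity
  -- The receiver's register is maximally mixed; `hsum` says that the rank-one terms add up to `N`
  -- times the identity, which fixes the normalisation.
  refine hasEntangledScheme_of_fintype ((Fintype.card ι : ℂ)⁻¹ • (1 : Matrix ι ι ℂ))
    (fun x s => (((Fintype.card ι * N : ℕ) : ℂ))⁻¹ • ∑ c, vecMulVec (z x s c) (star (z x s c)))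
    (PosSemidef.one.smul hpos')
    (fun x s => (posSemidef_sum _ fun c _ => posSemidef_vecMulVec_self_star _).smul hpos)
    ?_ ?_ ?_
  · simp [hcard]
  · intro x y hxy s t hst
    rw [smul_mul_smul_comm, Finset.sum_mul_sum]
    rw [Finset.sum_eq_zero, smul_zero]
    intro c _
    refine Finset.sum_eq_zero fun c' _ => ?_
    have h0 : z x s c ⬝ᵥ z y t c' = 0 := by
      have := hort x y hxy s t hst c c'
      simp only [dotProduct, z] at this ⊢
      exact_mod_cast congrArg (Int.cast : ℤ → ℂ) this
    rw [hstar, vecMulVec_mul_vecMulVec, h0]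
    simp
  · intro x
    ext i j
    have h := congrArg (Int.cast : ℤ → ℂ) (hsum x i j)
    push_cast at h
    rw [← Finset.smul_sum]
    simp only [hstar, Matrix.smul_apply, Matrix.sum_apply, vecMulVec_apply, z, smul_eq_mul, h, one_apply]
    split_ifs
    · push_cast
      field_simp
    · simp

end Schemes

/-! ### The group of even sign vectors, Hamming distance, and Hadamard cliques -/

section SignVectors

theorem even_card_neg_one_iff {k : ℕ} (v : Fin k → ℤˣ) :
    Even (Finset.univ.filter fun i => v i = -1).card ↔ ∏ i, v i = 1 := by
  have h : ∏ i, v i = (-1) ^ (Finset.univ.filter fun i => v i = -1).card := by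
    rw [← Finset.prod_const, Finset.prod_filter]
    refine Finset.prod_congr rfl fun i _ => ?_
    rcases Int.units_eq_one_or (v i) with h | h <;> simp [h]
  rw [h]
  rcases Nat.even_or_odd (Finset.univ.filter fun i => v i = -1).card with h | h
  · simp [h]
  · simp [h.neg_one_pow, Nat.not_even_iff_odd.2 h]

theorem card_evenSignVector_succ (k : ℕ) : Fintype.card (EvenSignVector (k + 1)) = 2 ^ k := by
  let e : EvenSignVector (k + 1) ≃ (Fin k → ℤˣ) :=
    { toFun := fun v => Fin.tail v.1
      invFun := fun v => ⟨Fin.cons (∏ i, v i) v, (even_card_neg_one_iff _).2 (by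
        rw [Fin.prod_univ_succ]
        simp [← sq])⟩
      left_inv := fun v => by
        have h := (even_card_neg_one_iff _).1 v.2
        rw [Fin.prod_univ_succ] at h
        ext1
        conv_rhs => rw [← Fin.cons_self_tail v.1]
        rw [← inv_eq_of_mul_eq_one_left h, Int.units_inv_eq_self]
        rfl
      right_inv := fun v => by simp }
  rw [Fintype.card_congr e]
  simp

/-- Coordinatewise multiplication of even sign vectors. -/
def EvenSignVector.mul {k : ℕ} (t u : EvenSignVector k) : EvenSignVector k :=
  ⟨t.1 * u.1, by
    have ht := (even_card_neg_one_iff _).1 t.2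
    have hu := (even_card_neg_one_iff _).1 u.2
    rw [even_card_neg_one_iff]
    simp [Finset.prod_mul_distrib, ht, hu]⟩

theorem EvenSignVector.mul_comm {k : ℕ} (t u : EvenSignVector k) : t.mul u = u.mul t :=
  Subtype.ext (_root_.mul_comm _ _)

theorem EvenSignVector.mul_mul_cancel {k : ℕ} (t u : EvenSignVector k) :
    t.mul (t.mul u) = u := by
  ext i
  simp [EvenSignVector.mul, ← mul_assoc]

/-- The graph is a Cayley graph of the group of even sign vectors, so translates of cliques are
cliques. -/
theorem adj_mul_mul_iff {k : ℕ} (t u v : EvenSignVector k) :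
    (quarterOrthogonalityGraph k).Adj (t.mul u) (t.mul v) ↔
      (quarterOrthogonalityGraph k).Adj u v := by
  have h : ∀ i, (((t.mul u).1 i : ℤˣ) : ℤ) * ((t.mul v).1 i : ℤˣ) = (u.1 i : ℤ) * (v.1 i : ℤ) := by
    intro i
    have ht : ((t.1 i : ℤˣ) : ℤ) * (t.1 i : ℤˣ) = 1 := by
      rw [← Units.val_mul, Int.units_mul_self, Units.val_one]
    simp only [EvenSignVector.mul, Pi.mul_apply, Units.val_mul]
    linear_combination ((u.1 i : ℤˣ) : ℤ) * (v.1 i : ℤˣ) * ht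
  simp only [quarterOrthogonalityGraph, h]

/-- The Hamming distance of two even sign vectors. -/
def signDist {k : ℕ} (u v : EvenSignVector k) : ℕ :=
  (Finset.univ.filter fun i => u.1 i ≠ v.1 i).card

theorem signDist_eq_zero {k : ℕ} {u v : EvenSignVector k} : signDist u v = 0 ↔ u = v := by
  simp [signDist, Finset.filter_eq_empty_iff, Subtype.ext_iff, funext_iff]

theorem signDist_le {k : ℕ} (u v : EvenSignVector k) : signDist u v ≤ k :=
  (Finset.card_le_univ _).trans_eq (Fintype.card_fin k)

theorem even_signDist {k : ℕ} (u v : EvenSignVector k) : Even (signDist u v) := by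
  have h := (u.mul v).2
  have hset : (Finset.univ.filter fun i => u.1 i ≠ v.1 i) =
      Finset.univ.filter fun i => (u.mul v).1 i = -1 := by
    refine Finset.filter_congr fun i _ => ?_
    rcases Int.units_eq_one_or (u.1 i) with hu | hu <;>
      rcases Int.units_eq_one_or (v.1 i) with hv | hv <;>
      simp [EvenSignVector.mul, hu, hv]
  rwa [signDist, hset]

theorem sum_mul_eq_sub_signDist {k : ℕ} (u v : EvenSignVector k) :
    ∑ i, (u.1 i : ℤ) * (v.1 i : ℤ) = k - 2 * signDist u v := by
  have h : ∀ i, (u.1 i : ℤ) * (v.1 i : ℤ) = 1 - 2 * if u.1 i ≠ v.1 i then 1 else 0 := by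
    intro i
    rcases Int.units_eq_one_or (u.1 i) with hu | hu <;>
      rcases Int.units_eq_one_or (v.1 i) with hv | hv <;>
      simp [hu, hv]
  simp only [h, Finset.sum_sub_distrib, ← Finset.mul_sum, Finset.sum_boole, signDist]
  simp

theorem adj_iff_signDist {k q : ℕ} (hk : k + 1 = 4 * q) (u v : EvenSignVector k) :
    (quarterOrthogonalityGraph k).Adj u v ↔ signDist u v = 2 * q := by
  change ∑ i, (u.1 i : ℤ) * (v.1 i : ℤ) = -1 ↔ _
  rw [sum_mul_eq_sub_signDist]
  lia

/-- The vector `(1, u)` of length `k + 1`. -/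
def extendByOne {k : ℕ} (u : EvenSignVector k) : Fin (k + 1) → ℤ :=
  Fin.cons 1 fun i => (u.1 i : ℤ)

theorem adj_iff_extendByOne {k : ℕ} (u v : EvenSignVector k) :
    (quarterOrthogonalityGraph k).Adj u v ↔ ∑ i, extendByOne u i * extendByOne v i = 0 := by
  change ∑ i, (u.1 i : ℤ) * (v.1 i : ℤ) = -1 ↔ _
  rw [Fin.sum_univ_succ]
  simp only [extendByOne, Fin.cons_zero, Fin.cons_succ]
  lia

theorem extendByOne_mul {k : ℕ} (t u : EvenSignVector k) (i : Fin (k + 1)) :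
    extendByOne (t.mul u) i = extendByOne t i * extendByOne u i := by
  refine Fin.cases ?_ (fun i => ?_) i <;> simp [extendByOne, EvenSignVector.mul]

theorem extendByOne_mul_self {k : ℕ} (u : EvenSignVector k) (i : Fin (k + 1)) :
    extendByOne u i * extendByOne u i = 1 := by
  refine Fin.cases ?_ (fun i => ?_) i
  · simp [extendByOne]
  · simp only [extendByOne, Fin.cons_succ]
    rw [← Units.val_mul, Int.units_mul_self, Units.val_one]

/-- A Hadamard matrix of size `k + 1 = 4q` gives a clique of size `k + 1`, whose extended vectors
are the rows of a Hadamard matrix. -/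
theorem exists_hadamard_clique {k q : ℕ} (hk : k + 1 = 4 * q)
    {A : Matrix (Fin (k + 1)) (Fin (k + 1)) ℤ} (hA : A.IsHadamard) :
    ∃ B : Fin (k + 1) → EvenSignVector k,
      (∀ a b, a ≠ b → (quarterOrthogonalityGraph k).Adj (B a) (B b)) ∧
      ∀ i j, ∑ a, extendByOne (B a) i * extendByOne (B a) j = if i = j then (k : ℤ) + 1 else 0 := by
  have hent : ∀ i j, ∃ u : ℤˣ, (u : ℤ) = A i j := fun i j => by
    have h : A i j * A i j = 1 := by simpa using Unitary.mul_star_self_of_mem (hA.apply_mem i j)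
    exact ⟨⟨A i j, A i j, h, h⟩, rfl⟩
  choose U hU using hent
  have hsq : ∀ i j, (U i j : ℤ) * U i j = 1 := fun i j => by
    rw [← Units.val_mul, Int.units_mul_self, Units.val_one]
  have hrow : ∀ a b, ∑ i, (U a i : ℤ) * U b i = if a = b then (k : ℤ) + 1 else 0 := fun a b => by
    have := congrFun (congrFun hA.mul_conjTranspose a) b
    simpa [Matrix.mul_apply, hU, Matrix.smul_apply, Matrix.one_apply] using this
  have hcol : ∀ i j, ∑ a, (U a i : ℤ) * U a j = if i = j then (k : ℤ) + 1 else 0 := fun a b => by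
    have := congrFun (congrFun hA.conjTranspose_mul a) b
    simpa [Matrix.mul_apply, hU, Matrix.smul_apply, Matrix.one_apply] using this
  -- Rescaling rows and columns by signs makes the zeroth row and column all ones and preserves both
  -- orthogonality relations.
  let X : Fin (k + 1) → Fin (k + 1) → ℤˣ := fun a i => U a 0 * U a i * U 0 i * U 0 0
  have hX0 : ∀ a, X a 0 = 1 := fun a => by
    simp [X, Int.units_mul_self, mul_assoc]
  have hX1 : ∀ i, X 0 i = 1 := fun i => by
    simp only [X]
    rw [mul_assoc (U 0 0), Int.units_mul_self, mul_one, Int.units_mul_self]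
  have hXrow : ∀ a b, ∑ i, (X a i : ℤ) * X b i = if a = b then (k : ℤ) + 1 else 0 := fun a b => by
    have : ∀ i, (X a i : ℤ) * X b i = (U a 0 * U b 0 : ℤ) * ((U a i : ℤ) * U b i) := fun i => by
      simp only [X, Units.val_mul]
      linear_combination (U a 0 * U b 0 * U a i * U b i : ℤ) *
        (hsq 0 i * (U 0 0 * U 0 0 : ℤ) + hsq 0 0)
    rw [Finset.sum_congr rfl fun i _ => this i, ← Finset.mul_sum, hrow]
    split_ifs with h
    · rw [h, hsq, one_mul]
    · simp
  have hXcol : ∀ i j, ∑ a, (X a i : ℤ) * X a j = if i = j then (k : ℤ) + 1 else 0 := fun i j => by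
    have : ∀ a, (X a i : ℤ) * X a j = (U 0 i * U 0 j : ℤ) * ((U a i : ℤ) * U a j) := fun a => by
      simp only [X, Units.val_mul]
      linear_combination (U 0 i * U 0 j * U a i * U a j : ℤ) *
        (hsq a 0 * (U 0 0 * U 0 0 : ℤ) + hsq 0 0)
    rw [Finset.sum_congr rfl fun a _ => this a, ← Finset.mul_sum, hcol]
    split_ifs with h
    · rw [h, hsq, one_mul]
    · simp
  have hrowsum : ∀ a, a ≠ 0 → ∑ i : Fin k, (X a i.succ : ℤ) = -1 := fun a ha => by
    have h := hXrow a 0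
    rw [if_neg ha, Fin.sum_univ_succ] at h
    simp only [hX0, hX1, Units.val_one, mul_one] at h
    lia
  -- A row orthogonal to the all-ones row has exactly 2q entries −1, an even number; dropping the
  -- leading 1 does not change this count.
  have heven : ∀ a, Even (Finset.univ.filter fun i : Fin k => X a i.succ = -1).card := fun a => by
    by_cases ha : a = 0
    · simp [ha, hX1]
    · have h := hrowsum a ha
      have hval : ∀ i : Fin k, (X a i.succ : ℤ) = 1 - 2 * if X a i.succ = -1 then 1 else 0 :=
        fun i => by
          rcases Int.units_eq_one_or (X a i.succ) with hu | hu <;> simp [hu]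
      rw [Finset.sum_congr rfl fun i _ => hval i, Finset.sum_sub_distrib, ← Finset.mul_sum,
        Finset.sum_boole] at h
      simp only [Finset.sum_const, Finset.card_univ, Fintype.card_fin] at h
      have h2 : (Finset.univ.filter fun i : Fin k => X a i.succ = -1).card = 2 * q := by
        simp at h
        lia
      rw [h2]
      exact even_two_mul q
  let B : Fin (k + 1) → EvenSignVector k := fun a => ⟨fun i => X a i.succ, heven a⟩
  have hB : ∀ a i, extendByOne (B a) i = X a i := fun a i => by
    refine Fin.cases ?_ (fun i => ?_) i <;> simp [extendByOne, B, hX0]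
  refine ⟨B, fun a b hab => ?_, fun i j => ?_⟩
  · rw [adj_iff_extendByOne]
    simp only [hB, hXrow, if_neg hab]
  · simp only [hB, hXcol]

end SignVectors

/-! ### The entangled scheme from a packing of clique translates -/

section EntangledScheme

theorem sum_pi_prod {m : ℕ} {α R : Type*} [Fintype α] [CommSemiring R] (f : Fin m → α → R) :
    ∑ c : Fin m → α, ∏ a, f a (c a) = ∏ a, ∑ b, f a b := by
  classical
  rw [Finset.prod_univ_sum, Fintype.piFinset_univ]

theorem prod_ite_eq_pow {m : ℕ} {α : Type*} [DecidableEq α] (i j : Fin m → α) (N : ℤ) :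
    (∏ a, if i a = j a then N else 0) = if i = j then N ^ m else 0 := by
  split_ifs with h
  · simp [h]
  · obtain ⟨a, ha⟩ := Function.ne_iff.1 h
    exact Finset.prod_eq_zero (Finset.mem_univ a) (if_neg ha)

/-- A maximal packing of translates of a set of size `N` in the group of even sign vectors. -/
theorem exists_packing {k N : ℕ} (B : Fin N → EvenSignVector k) (hN : N ≠ 0) :
    ∃ T : Finset (EvenSignVector k),
      (∀ t ∈ T, ∀ t' ∈ T, ∀ a b, t.mul (B a) = t'.mul (B b) → t = t') ∧
      Fintype.card (EvenSignVector k) ≤ T.card * N ^ 2 := by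
  classical
  let P : Finset (EvenSignVector k) → Prop := fun T =>
    ∀ t ∈ T, ∀ t' ∈ T, ∀ a b, t.mul (B a) = t'.mul (B b) → t = t'
  obtain ⟨T, hT, hmax⟩ := Finset.exists_max_image (Finset.univ.filter P) Finset.card
    ⟨∅, by simp [P]⟩
  simp only [Finset.mem_filter, Finset.mem_univ, true_and] at hT hmax
  refine ⟨T, hT, ?_⟩
  -- By maximality every translate vB meets some tB, and since all elements are involutions v = t ·
  -- B a · B b. This is the source of the factor `N ^ 2`.
  have hcov : ∀ v, ∃ t ∈ T, ∃ a b, (t.mul (B a)).mul (B b) = v := by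
    intro v
    have hback : ∀ (t : EvenSignVector k) a b, t.mul (B a) = v.mul (B b) → (t.mul (B a)).mul (B b) = v := by
      intro t a b h
      rw [h, EvenSignVector.mul_comm, EvenSignVector.mul_comm v, EvenSignVector.mul_mul_cancel]
    by_contra! hno
    have hvT : v ∉ T := fun hv => hno v hv ⟨0, Nat.pos_of_ne_zero hN⟩ ⟨0, Nat.pos_of_ne_zero hN⟩
      (hback _ _ _ rfl)
    have hins : P (insert v T) := by
      intro t ht t' ht' a b h
      rcases Finset.mem_insert.1 ht with rfl | ht1 <;> rcases Finset.mem_insert.1 ht' with rfl | ht2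
      · rfl
      · exact absurd (hback _ _ _ h.symm) (hno _ ht2 _ _)
      · exact absurd (hback _ _ _ h) (hno _ ht1 _ _)
      · exact hT t ht1 t' ht2 a b h
    have := hmax _ hins
    rw [Finset.card_insert_of_notMem hvT] at this
    lia
  have hsurj : Function.Surjective fun x : T × (Fin N × Fin N) =>
      (x.1.1.mul (B x.2.1)).mul (B x.2.2) := fun v => by
    obtain ⟨t, ht, a, b, h⟩ := hcov v
    exact ⟨⟨⟨t, ht⟩, a, b⟩, h⟩
  have := Fintype.card_le_of_surjective _ hsurj
  simpa [sq] using this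

/-- The hypothesis `hmn` lets the measurement outcomes, `k + 1` per source letter, be injected into
words of length `n` over the packing. -/
theorem hasEntangledScheme_of_packing {k : ℕ} {B : Fin (k + 1) → EvenSignVector k}
    (hBadj : ∀ a b, a ≠ b → (quarterOrthogonalityGraph k).Adj (B a) (B b))
    (hBcol : ∀ i j, ∑ a, extendByOne (B a) i * extendByOne (B a) j =
      if i = j then (k : ℤ) + 1 else 0)
    {T : Finset (EvenSignVector k)}
    (hT : ∀ t ∈ T, ∀ t' ∈ T, ∀ a b, t.mul (B a) = t'.mul (B b) → t = t')
    {m n : ℕ} (hmn : (k + 1) ^ m ≤ T.card ^ n) :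
    HasEntangledScheme (quarterOrthogonalityGraph k) (quarterOrthogonalityGraph k) m n := by
  classical
  obtain ⟨e⟩ : Nonempty ((Fin m → Fin (k + 1)) ↪ (Fin n → T)) :=
    Function.Embedding.nonempty_of_card_le (by simpa using hmn)
  have hBinj : Function.Injective B := fun a b h => by
    by_contra hab
    exact (hBadj a b hab).ne h
  -- Channel side: message t is sent by measuring in the orthogonal basis carried by the translate
  -- tB and transmitting the outcome s.
  let Q : EvenSignVector k → EvenSignVector k → Fin (k + 1) → ℤ := fun t s j =>
    if ∃ a, t.mul (B a) = s then extendByOne s j else 0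
  have hQsum : ∀ t i j, ∑ s, Q t s i * Q t s j = if i = j then (k : ℤ) + 1 else 0 := by
    intro t i j
    have hinj : Function.Injective fun a => t.mul (B a) := fun a b h => hBinj (by
      rw [← t.mul_mul_cancel (B a), ← t.mul_mul_cancel (B b)]
      exact congrArg t.mul h)
    have h1 : ∑ s, Q t s i * Q t s j = ∑ a, Q t (t.mul (B a)) i * Q t (t.mul (B a)) j := by
      rw [← Finset.sum_image (s := Finset.univ) (g := fun a => t.mul (B a))
        (f := fun s => Q t s i * Q t s j) hinj.injOn]
      refine (Finset.sum_subset (Finset.subset_univ _) fun s _ hs => ?_).symm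
      have : ¬ ∃ a, t.mul (B a) = s := by simpa using hs
      simp [Q, this]
    have h2 : ∀ a, Q t (t.mul (B a)) i * Q t (t.mul (B a)) j =
        (extendByOne t i * extendByOne t j) * (extendByOne (B a) i * extendByOne (B a) j) := by
      intro a
      simp only [Q, extendByOne_mul, exists_apply_eq_apply, if_true]
      ring
    rw [h1, Finset.sum_congr rfl fun a _ => h2 a, ← Finset.mul_sum, hBcol]
    split_ifs with hij
    · rw [hij, extendByOne_mul_self, one_mul]
    · simp
  -- Source side: for fixed x this is an orthogonal basis indexed by the outcome c; for equal
  -- outcomes, adjacent inputs leave orthogonal vectors.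
  let P : EvenSignVector k → Fin (k + 1) → Fin (k + 1) → ℤ := fun x c i =>
    extendByOne (B c) i * extendByOne x i
  have hPsum : ∀ x i j, ∑ c, P x c i * P x c j = if i = j then (k : ℤ) + 1 else 0 := by
    intro x i j
    have h2 : ∀ c, P x c i * P x c j =
        (extendByOne x i * extendByOne x j) * (extendByOne (B c) i * extendByOne (B c) j) := by
      intro c
      simp only [P]
      ring
    rw [Finset.sum_congr rfl fun c _ => h2 c, ← Finset.mul_sum, hBcol]
    split_ifs with hij
    · rw [hij, extendByOne_mul_self, one_mul]
    · simp
  have hPort : ∀ x y c, (quarterOrthogonalityGraph k).Adj x y → ∑ i, P x c i * P y c i = 0 := by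
    intro x y c h
    rw [adj_iff_extendByOne] at h
    rw [← h]
    refine Finset.sum_congr rfl fun i _ => ?_
    simp only [P]
    linear_combination (extendByOne x i * extendByOne y i) * extendByOne_mul_self (B c) i
  have hQort : ∀ t ∈ T, ∀ t' ∈ T, t ≠ t' → ∀ s s',
      (s = s' ∨ (quarterOrthogonalityGraph k).Adj s s') → ∑ j, Q t s j * Q t' s' j = 0 := by
    intro t ht t' ht' hne s s' hss
    simp only [Q]
    split_ifs with h1 h2
    · rcases hss with rfl | hss
      · obtain ⟨a, ha⟩ := h1
        obtain ⟨b, hb⟩ := h2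
        exact absurd (hT t ht t' ht' a b (ha.trans hb.symm)) hne
      · exact (adj_iff_extendByOne _ _).1 hss
    all_goals simp
  -- Equal outcomes c = c' are orthogonal through a factor of `P` where x and y differ; distinct
  -- outcomes through a factor of `Q`, because `e` is injective.
  let w : (Fin m → EvenSignVector k) → (Fin n → EvenSignVector k) → (Fin m → Fin (k + 1)) →
      (Fin m → Fin (k + 1)) × (Fin n → Fin (k + 1)) → ℤ := fun x s c i =>
    (∏ a, P (x a) (c a) (i.1 a)) * ∏ b, Q (e c b).1 (s b) (i.2 b)
  refine hasEntangledScheme_of_vectors w ((k + 1) ^ m * (k + 1) ^ n) (by positivity) ?_ ?_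
  · intro x y hxy s s' hss c c'
    have hw : dotProduct (w x s c) (w y s' c') = (∏ a, ∑ i, P (x a) (c a) i * P (y a) (c' a) i) *
        ∏ b, ∑ j, Q (e c b).1 (s b) j * Q (e c' b).1 (s' b) j := by
      rw [← sum_pi_prod, ← sum_pi_prod, dotProduct, Fintype.sum_prod_type, Finset.sum_mul_sum]
      refine Finset.sum_congr rfl fun i _ => Finset.sum_congr rfl fun j _ => ?_
      simp only [w, Finset.prod_mul_distrib]
      ring
    rw [hw]
    by_cases hc : c = c'
    · subst hc
      obtain ⟨a, ha⟩ := Function.ne_iff.1 hxy.1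
      rw [Finset.prod_eq_zero (Finset.mem_univ a) (hPort _ _ _ ((hxy.2 a).resolve_left ha)),
        zero_mul]
    · obtain ⟨b, hb⟩ := Function.ne_iff.1 (e.injective.ne hc)
      rw [Finset.prod_eq_zero (Finset.mem_univ b) (hQort _ (e c b).2 _ (e c' b).2
        (fun h => hb (Subtype.ext h)) _ _ (eq_or_strongPower_adj_iff.1 hss b)), mul_zero]
  · rintro x ⟨i, i'⟩ ⟨j, j'⟩
    have hinner : ∀ c, ∑ s, w x s c (i, i') * w x s c (j, j') =
        (∏ a, P (x a) (c a) (i a) * P (x a) (c a) (j a)) *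
          if i' = j' then ((k : ℤ) + 1) ^ n else 0 := by
      intro c
      have hpow : (if i' = j' then ((k : ℤ) + 1) ^ n else 0) =
          ∏ b, ∑ s, Q (e c b).1 s (i' b) * Q (e c b).1 s (j' b) := by
        simp only [hQsum, prod_ite_eq_pow]
      rw [hpow, ← sum_pi_prod fun b s => Q (e c b).1 s (i' b) * Q (e c b).1 s (j' b), Finset.mul_sum]
      refine Finset.sum_congr rfl fun s _ => ?_
      simp only [w, Finset.prod_mul_distrib]
      ring
    rw [Finset.sum_comm, Finset.sum_congr rfl fun c _ => hinner c, ← Finset.sum_mul,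
      sum_pi_prod fun a c => P (x a) c (i a) * P (x a) c (j a)]
    simp only [hPsum, prod_ite_eq_pow, Prod.mk.injEq]
    by_cases h1 : i = j <;> by_cases h2 : i' = j' <;> simp [h1, h2]

end EntangledScheme

/-! ### Rank bound on independent sets and the counting bound on classical schemes -/

section RankBound

/-- In (d + q)·C(d+q−1, q−1) = C(d+q, q)·q with q = p^ℓ, if p did not divide the binomial
coefficient on the left, then q would divide d + q. -/
theorem prime_dvd_choose_of_not_dvd {p ℓ d : ℕ} (hp : p.Prime) (hd : ¬ p ^ ℓ ∣ d) :
    p ∣ (d + (p ^ ℓ - 1)).choose (p ^ ℓ - 1) := by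
  by_contra h
  have hpos : 0 < p ^ ℓ := pow_pos hp.pos ℓ
  have hid := Nat.add_one_mul_choose_eq (d + (p ^ ℓ - 1)) (p ^ ℓ - 1)
  rw [add_assoc, Nat.sub_add_cancel hpos] at hid
  have hcop : Nat.Coprime (p ^ ℓ) ((d + (p ^ ℓ - 1)).choose (p ^ ℓ - 1)) :=
    ((Nat.Prime.coprime_iff_not_dvd hp).2 h).pow_left ℓ
  have h1 : p ^ ℓ ∣ d + p ^ ℓ := hcop.dvd_of_dvd_mul_right (hid ▸ dvd_mul_left _ _)
  exact hd ((Nat.dvd_add_left dvd_rfl).1 h1)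

/-- Vandermonde's identity, with the subsets of `D` grouped by size. -/
theorem choose_add_eq_sum_powerset {α : Type*} (D : Finset α) (r : ℕ) :
    (D.card + r).choose r = ∑ I ∈ D.powerset, r.choose I.card := by
  rw [Finset.sum_powerset_apply_card (fun i => r.choose i), ← Nat.choose_symm_add, add_comm,
    Nat.add_choose_eq,
    Finset.Nat.sum_antidiagonal_eq_sum_range_succ fun i j => r.choose i * D.card.choose j]
  refine Finset.sum_congr rfl fun i hi => ?_
  rw [Nat.choose_symm (Nat.lt_succ_iff.1 (Finset.mem_range.1 hi)), smul_eq_mul, mul_comm]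

/-- The binomial coefficient `(d + r).choose r` of the Hamming distance `d` is, in a field of
characteristic not two, a combination of products of characters of degree at most `r`. -/
theorem exists_choose_signDist_eq_sum {F : Type*} [Field F] (h2 : (2 : F) ≠ 0) (k r : ℕ) :
    ∃ a : Finset (Fin k) → F, ∀ u v : EvenSignVector k,
      (((signDist u v + r).choose r : ℕ) : F) =
        ∑ J ∈ Finset.univ.filter fun J : Finset (Fin k) => J.card ≤ r,
          (a J * ∏ j ∈ J, ((u.1 j : ℤ) : F)) * ∏ j ∈ J, ((v.1 j : ℤ) : F) := by
  classical
  refine ⟨fun J => (-1) ^ J.card * ∑ I ∈ Finset.univ.filter fun I => J ⊆ I,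
    (r.choose I.card : F) * (2⁻¹) ^ I.card, fun u v => ?_⟩
  let D : Finset (Fin k) := Finset.univ.filter fun i => u.1 i ≠ v.1 i
  -- The indicator of u_j ≠ v_j is (1 − u_j v_j)/2; multiplying over I and expanding produces
  -- products of characters.
  have hfac : ∀ j, (if j ∈ D then (1 : F) else 0) =
      2⁻¹ * (1 + -(((u.1 j : ℤ) : F) * ((v.1 j : ℤ) : F))) := fun j => by
    rcases Int.units_eq_one_or (u.1 j) with hu | hu <;>
      rcases Int.units_eq_one_or (v.1 j) with hv | hv <;>
      simp [D, hu, hv] <;> field_simp <;> norm_num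
  have hI : ∀ I : Finset (Fin k), (if I ⊆ D then (1 : F) else 0) =
      2⁻¹ ^ I.card * ∑ J ∈ I.powerset, (-1) ^ J.card *
        ((∏ j ∈ J, ((u.1 j : ℤ) : F)) * ∏ j ∈ J, ((v.1 j : ℤ) : F)) := fun I => by
    have h1 : (if I ⊆ D then (1 : F) else 0) = ∏ j ∈ I, if j ∈ D then (1 : F) else 0 := by
      rw [Finset.prod_ite_zero]
      simp [Finset.subset_iff]
    rw [h1, Finset.prod_congr rfl fun j _ => hfac j, Finset.prod_mul_distrib, Finset.prod_const,
      Finset.prod_one_add]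
    congr 1
    refine Finset.sum_congr rfl fun J _ => ?_
    rw [Finset.prod_neg, Finset.prod_mul_distrib]
  have hexp : (((signDist u v + r).choose r : ℕ) : F) =
      ∑ I, (r.choose I.card : F) * if I ⊆ D then (1 : F) else 0 := by
    rw [show signDist u v = D.card from rfl, choose_add_eq_sum_powerset, Nat.cast_sum]
    simp only [mul_ite, mul_one, mul_zero]
    rw [← Finset.sum_filter]
    refine Finset.sum_congr ?_ fun _ _ => rfl
    ext I
    simp
  rw [hexp]
  simp only [hI, Finset.mul_sum]
  rw [Finset.sum_comm' (t' := Finset.univ) (s' := fun J => Finset.univ.filter fun I => J ⊆ I)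
    (by simp)]
  rw [← Finset.sum_subset (Finset.subset_univ
    (Finset.univ.filter fun J : Finset (Fin k) => J.card ≤ r))]
  · refine Finset.sum_congr rfl fun J _ => ?_
    rw [Finset.sum_mul, Finset.sum_mul]
    refine Finset.sum_congr rfl fun I _ => ?_
    ring
  -- The degree truncation: |I| ≥ |J| > r makes `r.choose I.card` vanish.
  · intro J _ hJ
    refine Finset.sum_eq_zero fun I hI => ?_
    have h1 : r < J.card := by simpa using hJ
    have h2 : J.card ≤ I.card := Finset.card_le_card (Finset.mem_filter.1 hI).2
    rw [Nat.choose_eq_zero_of_lt (h1.trans_le h2)]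
    simp

/-- Distances are even and below 4q with q odd, so the only possible multiples of q are 0 (equality)
and 2q (adjacency). -/
theorem not_dvd_signDist {k q : ℕ} (hk : k + 1 = 4 * q) (hq : Odd q) {u v : EvenSignVector k}
    (hne : u ≠ v) (hadj : ¬ (quarterOrthogonalityGraph k).Adj u v) : ¬ q ∣ signDist u v := by
  rintro ⟨c, hc⟩
  have h0 : signDist u v ≠ 0 := fun h => hne (signDist_eq_zero.1 h)
  have h2 : signDist u v ≠ 2 * q := fun h => hadj ((adj_iff_signDist hk u v).2 h)
  have hle := signDist_le u v
  have heven := even_signDist u v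
  rw [hc] at h0 h2 hle heven
  have hceven : Even c := (Nat.even_mul.1 heven).resolve_left (Nat.not_even_iff_odd.2 hq)
  have hc4 : c < 4 := by
    by_contra h
    have : q * 4 ≤ q * c := Nat.mul_le_mul_left q (by lia)
    lia
  interval_cases c
  · simp at h0
  · exact absurd hceven (by decide)
  · exact h2 (mul_comm _ _)
  · exact absurd hceven (by decide)

/-- The rank bound on independent sets of strong powers of quarter-orthogonality graphs. -/
theorem card_le_of_independent {p ℓ k m : ℕ} (hp : p.Prime) (hodd : Odd p)
    (hk : k + 1 = 4 * p ^ ℓ) (S : Finset (Fin m → EvenSignVector k))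
    (hS : ∀ x ∈ S, ∀ y ∈ S, ¬ (strongPower (quarterOrthogonalityGraph k) m).Adj x y) :
    S.card ≤ (Finset.univ.filter fun J : Finset (Fin k) => J.card ≤ p ^ ℓ - 1).card ^ m := by
  classical
  have : Fact p.Prime := ⟨hp⟩
  have h2 : (2 : ZMod p) ≠ 0 := by
    intro h
    have h' : ((2 : ℕ) : ZMod p) = 0 := by exact_mod_cast h
    rw [ZMod.natCast_eq_zero_iff, Nat.prime_dvd_prime_iff_eq hp Nat.prime_two] at h'
    subst h'
    exact absurd hodd (by decide)
  set r := p ^ ℓ - 1 with hr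
  obtain ⟨a, ha⟩ := exists_choose_signDist_eq_sum h2 k r
  let 𝒥 := Finset.univ.filter fun J : Finset (Fin k) => J.card ≤ r
  let X : Matrix S (Fin m → 𝒥) (ZMod p) := fun x J =>
    ∏ i, (a (J i).1 * ∏ j ∈ (J i).1, (((x.1 i).1 j : ℤ) : ZMod p))
  let Y : Matrix (Fin m → 𝒥) S (ZMod p) := fun J y =>
    ∏ i, ∏ j ∈ (J i).1, (((y.1 i).1 j : ℤ) : ZMod p)
  -- The entry at (x, y) is a product of binomial coefficients: each is 1 at distance 0, and one
  -- vanishes mod p in a coordinate where x and y are distinct and non-adjacent.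
  have hXY : X * Y = 1 := by
    ext x y
    have h1 : (X * Y) x y = ∏ i, (((signDist (x.1 i) (y.1 i) + r).choose r : ℕ) : ZMod p) := by
      rw [Matrix.mul_apply]
      simp only [X, Y, ← Finset.prod_mul_distrib]
      rw [sum_pi_prod fun i (J : 𝒥) => (a J.1 * ∏ j ∈ J.1, (((x.1 i).1 j : ℤ) : ZMod p)) *
        ∏ j ∈ J.1, (((y.1 i).1 j : ℤ) : ZMod p)]
      refine Finset.prod_congr rfl fun i _ => ?_
      rw [ha]
      exact Finset.sum_coe_sort 𝒥 fun J => (a J * ∏ j ∈ J, (((x.1 i).1 j : ℤ) : ZMod p)) *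
        ∏ j ∈ J, (((y.1 i).1 j : ℤ) : ZMod p)
    rw [h1, Matrix.one_apply]
    split_ifs with hxy
    · refine Finset.prod_eq_one fun i _ => ?_
      rw [hxy, signDist_eq_zero.2 rfl]
      simp
    · have hne : x.1 ≠ y.1 := fun h => hxy (Subtype.ext h)
      obtain ⟨i, hi⟩ : ∃ i, ¬ (x.1 i = y.1 i ∨
          (quarterOrthogonalityGraph k).Adj (x.1 i) (y.1 i)) := by
        by_contra! h
        exact hS _ x.2 _ y.2 ⟨hne, h⟩
      rw [not_or] at hi
      refine Finset.prod_eq_zero (Finset.mem_univ i) ?_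
      rw [ZMod.natCast_eq_zero_iff]
      exact prime_dvd_choose_of_not_dvd hp (not_dvd_signDist hk hodd.pow hi.1 hi.2)
  have hrank := (Matrix.rank_mul_le_left X Y).trans X.rank_le_card_width
  rw [hXY, Matrix.rank_one] at hrank
  simpa [𝒥, Fintype.card_subtype] using hrank

/-- Entropy bound at density 1/4: weighting J by 3^(k−|J|) gives total mass 4^k, and each counted
set weighs at least 3^(k−r). -/
theorem card_filter_card_le_mul_pow {k r : ℕ} (hr : r ≤ k) :
    (Finset.univ.filter fun J : Finset (Fin k) => J.card ≤ r).card * 3 ^ (k - r) ≤ 4 ^ k := by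
  have h := Finset.sum_pow_mul_eq_add_pow (1 : ℕ) 3 (Finset.univ : Finset (Fin k))
  simp only [one_pow, one_mul, Finset.card_univ, Fintype.card_fin, Finset.powerset_univ] at h
  calc _ = ∑ J ∈ Finset.univ.filter fun J : Finset (Fin k) => J.card ≤ r, 3 ^ (k - r) := by simp
    _ ≤ ∑ J ∈ Finset.univ.filter fun J : Finset (Fin k) => J.card ≤ r, 3 ^ (k - J.card) := by
      refine Finset.sum_le_sum fun J hJ => Nat.pow_le_pow_right (by norm_num) ?_
      have := (Finset.mem_filter.1 hJ).2
      lia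
    _ ≤ ∑ J : Finset (Fin k), 3 ^ (k - J.card) :=
      Finset.sum_le_sum_of_subset (Finset.subset_univ _)
    _ = 4 ^ k := h

theorem card_filter_card_le_pow_le {k q : ℕ} (hq : 1 ≤ q) (hk : k + 1 = 4 * q) :
    (4 * (Finset.univ.filter fun J : Finset (Fin k) => J.card ≤ q - 1).card) ^ 4 ≤
      2 ^ (13 * q) := by
  have h := card_filter_card_le_mul_pow (k := k) (r := q - 1) (by lia)
  set b := (Finset.univ.filter fun J : Finset (Fin k) => J.card ≤ q - 1).card
  rw [show k - (q - 1) = 3 * q by lia] at h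
  have h1 : 4 * b * 27 ^ q ≤ 256 ^ q := by
    calc 4 * b * 27 ^ q = 4 * (b * 3 ^ (3 * q)) := by rw [pow_mul]; ring
      _ ≤ 4 * 4 ^ k := Nat.mul_le_mul_left 4 h
      _ = 4 ^ (k + 1) := by ring
      _ = 256 ^ q := by rw [hk, pow_mul]; norm_num
  have h2 : (4 * b * 27 ^ q) ^ 4 ≤ (256 ^ q) ^ 4 := Nat.pow_le_pow_left h1 4
  -- Numerically, 256⁴ ≤ 2¹³ · 27⁴; this is the origin of the constant 13/16.
  have h3 : (256 ^ q) ^ 4 ≤ (2 ^ 13) ^ q * (27 ^ q) ^ 4 := by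
    rw [pow_right_comm 256, pow_right_comm 27, ← mul_pow]
    exact Nat.pow_le_pow_left (by norm_num) q
  rw [mul_pow] at h2
  rw [pow_mul 2 13 q]
  exact Nat.le_of_mul_le_mul_right (h2.trans h3) (by positivity)

/-- Counting preimages of translates of powers of a clique bounds the cost of a scheme. -/
theorem card_mul_pow_le_of_hasScheme {k m n N b : ℕ} {B : Fin N → EvenSignVector k}
    (hB : ∀ a b, a ≠ b → (quarterOrthogonalityGraph k).Adj (B a) (B b))
    (hb : ∀ S : Finset (Fin m → EvenSignVector k),
      (∀ x ∈ S, ∀ y ∈ S, ¬ (strongPower (quarterOrthogonalityGraph k) m).Adj x y) → S.card ≤ b)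
    (h : HasScheme (quarterOrthogonalityGraph k) (quarterOrthogonalityGraph k) m n) :
    Fintype.card (EvenSignVector k) ^ m * N ^ n ≤ Fintype.card (EvenSignVector k) ^ n * b := by
  classical
  obtain ⟨f, hf⟩ := hasScheme_iff.1 h
  have hBinj : Function.Injective B := fun a b h => by
    by_contra hab
    exact (hB a b hab).ne h
  let P : (Fin n → EvenSignVector k) → (Fin m → EvenSignVector k) → Prop := fun t x =>
    ∃ c : Fin n → Fin N, ∀ i, f x i = (t i).mul (B (c i))
  have hP : ∀ t, Fintype.card {x // P t x} ≤ b := fun t => by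
    rw [Fintype.card_subtype]
    refine hb _ fun x hx y hy hxy => hf x y hxy fun i => ?_
    obtain ⟨c, hc⟩ := (Finset.mem_filter.1 hx).2
    obtain ⟨c', hc'⟩ := (Finset.mem_filter.1 hy).2
    rw [hc, hc']
    by_cases hcc : c i = c' i
    · exact Or.inl (by rw [hcc])
    · exact Or.inr ((adj_mul_mul_iff _ _ _).2 (hB _ _ hcc))
  -- Double counting of pairs (x, t) with f x in the t-translate of B^n: given x, each c determines
  -- t = f x · B c, since B c is an involution.
  let g : (Fin m → EvenSignVector k) × (Fin n → Fin N) → Σ t, {x // P t x} := fun z =>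
    ⟨fun i => (f z.1 i).mul (B (z.2 i)), z.1, z.2, fun i => by
      dsimp only
      rw [EvenSignVector.mul_comm, EvenSignVector.mul_comm (f z.1 i),
        EvenSignVector.mul_mul_cancel]⟩
  have hg : Function.Injective g := by
    rintro ⟨x, c⟩ ⟨y, c'⟩ h
    have hxy : x = y := congrArg (fun z : Σ t, {x // P t x} => z.2.1) h
    subst hxy
    have ht : (fun i => (f x i).mul (B (c i))) = fun i => (f x i).mul (B (c' i)) :=
      congrArg Sigma.fst h
    have hcc : c = c' := funext fun i => hBinj (by
      rw [← (f x i).mul_mul_cancel (B (c i)), ← (f x i).mul_mul_cancel (B (c' i))]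
      exact congrArg _ (congrFun ht i))
    rw [hcc]
  have hcard := Fintype.card_le_of_injective g hg
  rw [Fintype.card_sigma] at hcard
  have := hcard.trans (Finset.sum_le_card_nsmul _ _ _ fun t _ => hP t)
  simpa using this

end RankBound

/-! ### Passage to the limit and numerical estimates -/

section Rates

/-- Flipping two coordinates of the all-ones vector gives distance 2, which is less than 2q. -/
theorem exists_ne_not_adj {k q : ℕ} (hq : 2 ≤ q) (hk : k + 1 = 4 * q) :
    ∃ u v : EvenSignVector k, u ≠ v ∧ ¬ (quarterOrthogonalityGraph k).Adj u v := by
  let i : Fin k := ⟨0, by lia⟩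
  let j : Fin k := ⟨1, by lia⟩
  have hij : i ≠ j := by simp [i, j]
  let w : Fin k → ℤˣ := Pi.mulSingle i (-1) * Pi.mulSingle j (-1)
  have hw : ∏ l, w l = 1 := by
    simp [w, Finset.prod_mul_distrib]
  refine ⟨⟨1, (even_card_neg_one_iff _).2 (by simp)⟩, ⟨w, (even_card_neg_one_iff _).2 hw⟩,
    fun h => ?_, fun h => ?_⟩
  · have h1 := congrFun (congrArg Subtype.val h) i
    simp [w, hij] at h1
  · rw [adj_iff_signDist hk] at h
    have hle : signDist (⟨1, (even_card_neg_one_iff _).2 (by simp)⟩ : EvenSignVector k)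
        ⟨w, (even_card_neg_one_iff _).2 hw⟩ ≤ ({i, j} : Finset (Fin k)).card := by
      refine Finset.card_le_card fun l hl => ?_
      by_contra hl'
      simp only [Finset.mem_insert, Finset.mem_singleton, not_or] at hl'
      simp [w, Pi.mulSingle_eq_of_ne hl'.1, Pi.mulSingle_eq_of_ne hl'.2] at hl
    have := hle.trans Finset.card_le_two
    lia

theorem entangledCostRate_le_of_packing {V : Type*} [Fintype V] {G H : SimpleGraph V} {r : ℝ}
    (hr : 0 ≤ r) (hex : ∀ m, ∃ n, HasEntangledScheme G H m n)
    (h : ∀ m n : ℕ, m * r ≤ n → HasEntangledScheme G H m n) : entangledCostRate G H ≤ r := by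
  have hlim : Filter.Tendsto (fun m : ℕ => r + 1 / (m : ℝ)) Filter.atTop (nhds r) := by
    simpa using tendsto_const_nhds.add (tendsto_one_div_atTop_nhds_zero_nat (𝕜 := ℝ))
  refine le_of_tendsto_of_tendsto (tendsto_entangledCostRate hex) hlim ?_
  filter_upwards [Filter.eventually_gt_atTop 0] with m hm
  have hm' : (0 : ℝ) < m := Nat.cast_pos.2 hm
  have h1 : entangledMinCost G H m ≤ ⌈m * r⌉₊ := Nat.sInf_le (h m _ (Nat.le_ceil _))
  have h2 : (entangledMinCost G H m : ℝ) ≤ m * r + 1 :=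
    (Nat.cast_le.2 h1).trans (Nat.ceil_lt_add_one (by positivity)).le
  rw [div_le_iff₀ hm']
  field_simp
  linarith

theorem le_costRate {V W : Type*} {G : SimpleGraph V} {H : SimpleGraph W} {r : ℝ}
    (hex : ∀ m, ∃ n, HasScheme G H m n)
    (h : ∀ m n : ℕ, HasScheme G H m n → m * r ≤ n) : r ≤ costRate G H := by
  refine ge_of_tendsto (tendsto_costRate hex) ?_
  filter_upwards [Filter.eventually_gt_atTop 0] with m hm
  rw [le_div_iff₀ (Nat.cast_pos.2 hm), mul_comm]
  exact h m _ (Nat.sInf_mem (s := {n | HasScheme G H m n}) (hex m))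

/-- Keeps all denominators positive. The constant 9/20 is nearly sharp at k = 11, where it reads
12²⁰ ≤ 2⁷². -/
theorem logb_add_one_le {k : ℕ} (hk : 11 ≤ k) :
    Real.logb 2 ((k : ℝ) + 1) ≤ 9 / 20 * ((k : ℝ) - 3) := by
  obtain ⟨j, rfl⟩ := Nat.exists_eq_add_of_le hk
  have h : ∀ j : ℕ, (j + 12) ^ 20 ≤ 2 ^ (9 * j + 72) := by
    intro j
    induction j with
    | zero => norm_num
    | succ j ih =>
      have h1 : (12 * (j + 1 + 12)) ^ 20 ≤ (13 * (j + 12)) ^ 20 :=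
        Nat.pow_le_pow_left (by lia) 20
      rw [mul_pow, mul_pow] at h1
      have h2 : 2 ^ (9 * (j + 1) + 72) = 512 * 2 ^ (9 * j + 72) := by
        rw [show 9 * (j + 1) + 72 = 9 + (9 * j + 72) by ring, pow_add]
        norm_num
      have h3 : (13 : ℕ) ^ 20 ≤ 12 ^ 20 * 512 := by norm_num
      rw [h2]
      refine Nat.le_of_mul_le_mul_left (h1.trans ?_) (show 0 < 12 ^ 20 by norm_num)
      calc 13 ^ 20 * (j + 12) ^ 20 ≤ 12 ^ 20 * 512 * 2 ^ (9 * j + 72) := Nat.mul_le_mul h3 ih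
        _ = 12 ^ 20 * (512 * 2 ^ (9 * j + 72)) := mul_assoc _ _ _
  have h1 : ((j : ℝ) + 12) ^ 20 ≤ 2 ^ (9 * j + 72) := by exact_mod_cast h j
  have h2 := Real.logb_le_logb_of_le (b := 2) (by norm_num) (by positivity) h1
  rw [Real.logb_pow, Real.logb_pow, Real.logb_self_eq_one (by norm_num)] at h2
  push_cast at h2 ⊢
  rw [show (11 : ℝ) + j + 1 = j + 12 by ring]
  linarith

theorem entangledCostRate_quarterOrthogonalityGraph_le {k q : ℕ} (hk11 : 11 ≤ k)
    (hk : k + 1 = 4 * q) {A : Matrix (Fin (k + 1)) (Fin (k + 1)) ℤ} (hA : A.IsHadamard)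
    (hex : ∀ m, ∃ n, HasEntangledScheme (quarterOrthogonalityGraph k)
      (quarterOrthogonalityGraph k) m n) :
    entangledCostRate (quarterOrthogonalityGraph k) (quarterOrthogonalityGraph k) ≤
      Real.logb 2 ((k : ℝ) + 1) / ((k : ℝ) - 1 - 2 * Real.logb 2 ((k : ℝ) + 1)) := by
  obtain ⟨B, hBadj, hBcol⟩ := exists_hadamard_clique hk hA
  obtain ⟨T, hT, hcard⟩ := exists_packing B (by lia)
  have hL := logb_add_one_le hk11
  have hL0 : 0 ≤ Real.logb 2 ((k : ℝ) + 1) :=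
    Real.logb_nonneg (by norm_num) (by linarith [Nat.cast_nonneg (α := ℝ) k])
  have hk' : (11 : ℝ) ≤ k := by exact_mod_cast hk11
  set L := Real.logb 2 ((k : ℝ) + 1) with hLdef
  have hD : 0 < (k : ℝ) - 1 - 2 * L := by linarith
  have hV : Fintype.card (EvenSignVector k) = 2 ^ (k - 1) := by
    obtain ⟨j, rfl⟩ : ∃ j, k = j + 1 := ⟨k - 1, by lia⟩
    exact card_evenSignVector_succ j
  rw [hV] at hcard
  have hT0 : 0 < T.card := by
    refine Nat.pos_of_ne_zero fun h => ?_
    rw [h, zero_mul] at hcard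
    exact absurd hcard (by simp)
  have hT0' : (0 : ℝ) < T.card := Nat.cast_pos.2 hT0
  have hTlog : (k : ℝ) - 1 - 2 * L ≤ Real.logb 2 T.card := by
    have h1 : (2 : ℝ) ^ (k - 1) ≤ T.card * ((k : ℝ) + 1) ^ 2 := by exact_mod_cast hcard
    have h2 := Real.logb_le_logb_of_le (b := 2) (by norm_num) (by positivity) h1
    rw [Real.logb_mul hT0'.ne' (by positivity), Real.logb_pow, Real.logb_pow,
      Real.logb_self_eq_one (by norm_num), Nat.cast_sub (by lia)] at h2
    push_cast at h2
    linarith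
  refine entangledCostRate_le_of_packing (by positivity) hex fun m n hmn =>
    hasEntangledScheme_of_packing hBadj hBcol hT ?_
  have h1 : m * L ≤ n * Real.logb 2 T.card := by
    rw [← mul_div_assoc, div_le_iff₀ hD] at hmn
    exact hmn.trans (mul_le_mul_of_nonneg_left hTlog (Nat.cast_nonneg n))
  rw [hLdef, ← Real.logb_pow, ← Real.logb_pow,
    Real.logb_le_logb (by norm_num) (by positivity) (by positivity)] at h1
  exact_mod_cast h1

theorem le_costRate_quarterOrthogonalityGraph {p ℓ k : ℕ} (hp : p.Prime) (hodd : Odd p)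
    (hk11 : 11 ≤ k) (hk : k + 1 = 4 * p ^ ℓ) {A : Matrix (Fin (k + 1)) (Fin (k + 1)) ℤ}
    (hA : A.IsHadamard)
    (hex : ∀ m, ∃ n, HasScheme (quarterOrthogonalityGraph k) (quarterOrthogonalityGraph k) m n) :
    (3 / 16 * (k : ℝ) - 1) / ((k : ℝ) - 1 - Real.logb 2 ((k : ℝ) + 1)) ≤
      costRate (quarterOrthogonalityGraph k) (quarterOrthogonalityGraph k) := by
  obtain ⟨B, hBadj, -⟩ := exists_hadamard_clique hk hA
  have hL := logb_add_one_le hk11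
  have hk' : (11 : ℝ) ≤ k := by exact_mod_cast hk11
  have hq : 1 ≤ p ^ ℓ := Nat.one_le_pow _ _ hp.pos
  have hb := card_filter_card_le_pow_le hq hk
  have hind := fun m => card_le_of_independent (m := m) hp hodd hk
  set b := (Finset.univ.filter fun J : Finset (Fin k) => J.card ≤ p ^ ℓ - 1).card with hbdef
  have hb0 : 0 < b := Finset.card_pos.2 ⟨∅, by simp⟩
  have hb0' : (0 : ℝ) < b := Nat.cast_pos.2 hb0
  have hblog : Real.logb 2 b ≤ 13 / 16 * k := by
    have h1 : (4 * (b : ℝ)) ^ 4 ≤ 2 ^ (13 * p ^ ℓ) := by exact_mod_cast hb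
    have h2 := Real.logb_le_logb_of_le (b := 2) (by norm_num) (by positivity) h1
    rw [Real.logb_pow, Real.logb_pow, Real.logb_self_eq_one (by norm_num),
      Real.logb_mul (by norm_num) hb0'.ne', show (4 : ℝ) = 2 ^ 2 by norm_num, Real.logb_pow,
      Real.logb_self_eq_one (by norm_num)] at h2
    have h3 : (k : ℝ) + 1 = 4 * ((p ^ ℓ : ℕ) : ℝ) := by exact_mod_cast hk
    rw [Nat.cast_mul] at h2
    push_cast at h2 h3
    linarith
  set L := Real.logb 2 ((k : ℝ) + 1) with hLdef
  have hD : 0 < (k : ℝ) - 1 - L := by linarith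
  have hV : Fintype.card (EvenSignVector k) = 2 ^ (k - 1) := by
    obtain ⟨j, rfl⟩ : ∃ j, k = j + 1 := ⟨k - 1, by lia⟩
    exact card_evenSignVector_succ j
  refine le_costRate hex fun m n hmn => ?_
  have h := card_mul_pow_le_of_hasScheme hBadj (hind m) hmn
  rw [hV, ← pow_mul, ← pow_mul] at h
  have h1 : (2 : ℝ) ^ ((k - 1) * m) * ((k : ℝ) + 1) ^ n ≤ 2 ^ ((k - 1) * n) * (b : ℝ) ^ m := by
    exact_mod_cast h
  have h2 := Real.logb_le_logb_of_le (b := 2) (by norm_num) (by positivity) h1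
  rw [Real.logb_mul (by positivity) (by positivity), Real.logb_mul (by positivity) (by positivity),
    Real.logb_pow, Real.logb_pow, Real.logb_pow, Real.logb_pow,
    Real.logb_self_eq_one (by norm_num), Nat.cast_mul, Nat.cast_mul, Nat.cast_sub (by lia)] at h2
  have h3 : (m : ℝ) * Real.logb 2 b ≤ m * (13 / 16 * k) :=
    mul_le_mul_of_nonneg_left hblog (Nat.cast_nonneg m)
  rw [← mul_div_assoc, div_le_iff₀ hD]
  push_cast at h2
  linarith

end Rates

theorem quarterOrthogonalityGraph_rates {p ℓ k : ℕ} (hp : p.Prime) (hodd : Odd p) (hℓ : 1 ≤ ℓ)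
    (hA : ∃ A : Matrix (Fin (4 * p ^ ℓ)) (Fin (4 * p ^ ℓ)) ℤ, A.IsHadamard)
    (hk : k = 4 * p ^ ℓ - 1) :
    11 ≤ k ∧
    (∀ m : ℕ, ∃ n : ℕ,
      HasScheme (quarterOrthogonalityGraph k) (quarterOrthogonalityGraph k) m n) ∧
    entangledCostRate (quarterOrthogonalityGraph k) (quarterOrthogonalityGraph k) ≤
      Real.logb 2 ((k : ℝ) + 1) /
        (((k : ℝ) - 1) * (1 - 2 * Real.logb 2 ((k : ℝ) + 1) / ((k : ℝ) - 3))) ∧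
    (0.154 * (k : ℝ) - 1) / ((k : ℝ) - 1 - Real.logb 2 ((k : ℝ) + 1)) <
      costRate (quarterOrthogonalityGraph k) (quarterOrthogonalityGraph k) := by
  have hp3 : 3 ≤ p := by
    have := hp.two_le
    rcases hodd with ⟨c, rfl⟩
    lia
  have hq3 : 3 ≤ p ^ ℓ := hp3.trans (Nat.le_self_pow (by lia) p)
  have hk1 : k + 1 = 4 * p ^ ℓ := by lia
  have hk11 : 11 ≤ k := by lia
  rw [← hk1] at hA
  obtain ⟨A, hA⟩ := hA
  obtain ⟨u, v, huv, hnadj⟩ := exists_ne_not_adj (by lia) hk1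
  have hex : ∀ m, ∃ n, HasScheme (quarterOrthogonalityGraph k) (quarterOrthogonalityGraph k) m n :=
    hasScheme_of_not_adj huv hnadj
  have hL := logb_add_one_le hk11
  have hk' : (11 : ℝ) ≤ k := by exact_mod_cast hk11
  have hL0 : 0 ≤ Real.logb 2 ((k : ℝ) + 1) := Real.logb_nonneg (by norm_num) (by linarith)
  have hup := entangledCostRate_quarterOrthogonalityGraph_le hk11 hk1 hA
    fun m => (hex m).imp fun _ h => h.hasEntangledScheme
  have hlow := le_costRate_quarterOrthogonalityGraph hp hodd hk11 hk1 hA hex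
  set L := Real.logb 2 ((k : ℝ) + 1)
  have hk3 : (0 : ℝ) < k - 3 := by linarith
  have hfrac : 2 * L / ((k : ℝ) - 3) ≤ 9 / 10 := by
    rw [div_le_iff₀ hk3]
    linarith
  refine ⟨hk11, hex, hup.trans ?_, lt_of_lt_of_le ?_ hlow⟩
  -- Since (k − 1)/(k − 3) ≥ 1, the stated denominator is at most k − 1 − 2L.
  · refine div_le_div_of_nonneg_left hL0 (mul_pos (by linarith) (by linarith)) ?_
    have h1 : 2 * L / ((k : ℝ) - 3) * (k - 3) = 2 * L := div_mul_cancel₀ _ hk3.ne'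
    have h2 : 0 ≤ 2 * L / ((k : ℝ) - 3) := by positivity
    linarith
  -- Strictness comes from 3/16 > 0.154.
  · refine div_lt_div_of_pos_right ?_ (by linarith)
    norm_num
    linarith

theorem mainTheorem4 :
    (∀ (p ℓ k : ℕ), p.Prime → Odd p → 1 ≤ ℓ →
      (∃ A : Matrix (Fin (4 * p ^ ℓ)) (Fin (4 * p ^ ℓ)) ℤ, A.IsHadamard) →
      k = 4 * p ^ ℓ - 1 →
      -- the minima and limits that define the two cost rates exist
      ((∀ m : ℕ, 1 ≤ m → ∃ n : ℕ,
          HasScheme (quarterOrthogonalityGraph k) (quarterOrthogonalityGraph k) m n) ∧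
        (∀ m : ℕ, 1 ≤ m → ∃ n : ℕ,
          HasEntangledScheme (quarterOrthogonalityGraph k) (quarterOrthogonalityGraph k) m n) ∧
        Filter.Tendsto
          (fun m : ℕ => (minCost (quarterOrthogonalityGraph k)
            (quarterOrthogonalityGraph k) m : ℝ) / m)
          Filter.atTop
          (nhds (costRate (quarterOrthogonalityGraph k) (quarterOrthogonalityGraph k))) ∧
        Filter.Tendsto
          (fun m : ℕ => (entangledMinCost (quarterOrthogonalityGraph k)
            (quarterOrthogonalityGraph k) m : ℝ) / m)
          Filter.atTop
          (nhds (entangledCostRate (quarterOrthogonalityGraph k)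
            (quarterOrthogonalityGraph k)))) ∧
      -- the explicit bounds
      entangledCostRate (quarterOrthogonalityGraph k) (quarterOrthogonalityGraph k) ≤
        Real.logb 2 ((k : ℝ) + 1) /
          (((k : ℝ) - 1) * (1 - 2 * Real.logb 2 ((k : ℝ) + 1) / ((k : ℝ) - 3))) ∧
      (0.154 * (k : ℝ) - 1) / ((k : ℝ) - 1 - Real.logb 2 ((k : ℝ) + 1)) <
        costRate (quarterOrthogonalityGraph k) (quarterOrthogonalityGraph k)) ∧
    -- the asymptotic separation, with absolute constants
    (∃ C c : ℝ, 0 < C ∧ 0 < c ∧ ∀ (p ℓ k : ℕ), p.Prime → Odd p → 1 ≤ ℓ →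
      (∃ A : Matrix (Fin (4 * p ^ ℓ)) (Fin (4 * p ^ ℓ)) ℤ, A.IsHadamard) →
      k = 4 * p ^ ℓ - 1 →
      entangledCostRate (quarterOrthogonalityGraph k) (quarterOrthogonalityGraph k) ≤
          C * (Real.logb 2 (k : ℝ) / (k : ℝ)) ∧
        c ≤ costRate (quarterOrthogonalityGraph k) (quarterOrthogonalityGraph k)) := by
  refine ⟨fun p ℓ k hp hodd hℓ hA hk => ?_, 40, 0.06, by norm_num, by norm_num,
    fun p ℓ k hp hodd hℓ hA hk => ?_⟩
  · obtain ⟨-, hex, hup, hlow⟩ := quarterOrthogonalityGraph_rates hp hodd hℓ hA hk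
    have hexE := fun m => (hex m).imp fun _ h => h.hasEntangledScheme
    exact ⟨⟨fun m _ => hex m, fun m _ => hexE m, tendsto_costRate hex,
      tendsto_entangledCostRate hexE⟩, hup, hlow⟩
  · obtain ⟨hk11, -, hup, hlow⟩ := quarterOrthogonalityGraph_rates hp hodd hℓ hA hk
    have hL := logb_add_one_le hk11
    have hk' : (11 : ℝ) ≤ k := by exact_mod_cast hk11
    have hL0 : 0 ≤ Real.logb 2 ((k : ℝ) + 1) := Real.logb_nonneg (by norm_num) (by linarith)
    have hL2 : Real.logb 2 ((k : ℝ) + 1) ≤ 2 * Real.logb 2 k := by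
      have h1 := Real.logb_le_logb_of_le (b := 2) (x := (k : ℝ) + 1) (y := (k : ℝ) ^ 2)
        (by norm_num) (by positivity) (by nlinarith)
      rwa [Real.logb_pow, Nat.cast_ofNat] at h1
    set L := Real.logb 2 ((k : ℝ) + 1)
    have hk3 : (0 : ℝ) < k - 3 := by linarith
    have hfrac : 2 * L / ((k : ℝ) - 3) ≤ 9 / 10 := by
      rw [div_le_iff₀ hk3]
      linarith
    constructor
    -- The constant 40 is 2 · 20: the 2 comes from log(k + 1) ≤ 2 log k, the 20 from (k − 1)/10 ≥
    -- k/20.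
    · have hden : (k : ℝ) / 20 ≤ ((k : ℝ) - 1) * (1 - 2 * L / ((k : ℝ) - 3)) := by
        calc (k : ℝ) / 20 ≤ ((k : ℝ) - 1) * (1 / 10) := by linarith
          _ ≤ _ := mul_le_mul_of_nonneg_left (by linarith) (by linarith)
      calc _ ≤ L / (((k : ℝ) - 1) * (1 - 2 * L / ((k : ℝ) - 3))) := hup
        _ ≤ L / (k / 20) := div_le_div_of_nonneg_left hL0 (by positivity) hden
        _ ≤ 2 * Real.logb 2 k / (k / 20) := div_le_div_of_nonneg_right hL2 (by positivity)
        _ = 40 * (Real.logb 2 k / k) := by field_simp; ring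
    · refine le_trans ?_ hlow.le
      rw [le_div_iff₀ (by linarith)]
      norm_num
      linarith
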